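/- Let $K$ be an infinite field (for instance $K=\mathbb{C}$), let $\mathcal{H}$ be a $K$-vector space of finite dimension $N$, and let $R=S^{\bullet}(\mathcal{H}^*)$ be the ring of polynomials on $\mathcal{H}$, with degree-$k$ part $R_k=S^k(\mathcal{H}^*)$. Let $I\subseteq R$ be a homogeneous ideal, $I_k=I\cap R_k$, and let $\mathcal{X}=V(I)\subseteq\mathbb{P}(\mathcal{H})$ be the projective variety cut out by $I$. Let $I_k^{\perp}\subseteq S^k(\mathcal{H})\subseteq\mathcal{H}^{\otimes k}$ be the orthogonal complement of $I_k$ under the natural pairing between $S^k(\mathcal{H}^*)$ and the symmetric tensors $S^k(\mathcal{H})$, and let $\mathcal{X}^k=\mathrm{span}\{\psi^{\otimes k} : 0\ne\psi\in\mathcal{H},\ [\psi]\in\mathcal{X}\}$. For a subspace $\mathcal{U}\subseteq\mathcal{H}$ let $I(\mathcal{U})\subseteq R$ be the ideal of polynomials vanishing on $\mathcal{U}$. Call $\mathcal{U}$ \emph{$\mathcal{X}$-tangled} if it contains no nonzero $\psi$ with $[\psi]\in\mathcal{X}$. A property holds for a \emph{generically chosen} $s$-dimensional subspace if it holds on a Zariski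 open dense subset of the Grassmannian of $s$-dimensional subspaces of $\mathcal{H}$ (a projective variety via the Plücker embedding). Let $s,k$ be positive integers with $s\le N$. (1) If $\dim I_k^{\perp}<\binom{N-s+k}{k}$, then a generically chosen $s$-dimensional subspace $\mathcal{U}\subseteq\mathcal{H}$ satisfies $I_k+I(\mathcal{U})_k=R_k$ and $I_k^{\perp}\cap\mathcal{U}^{\otimes k}=\{0\}$ (that is, it is certified at level $k$ of the Nullstellensatz hierarchy), and is $\mathcal{X}$-tangled. (2) If $\dim \mathcal{X}^k<\binom{N-s+k}{k}$, then a generically chosen $s$-dimensional subspace $\mathcal{U}\subseteq\mathcal{H}$ is $\mathcal{X}$-tangled and satisfies $\mathcal{X}^k\cap\mathcal{U}^{\otimes k}=\{0\}$. -/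

import Mathlib

open Module
open scoped TensorProduct LinearAlgebra.Projectivization

noncomputable section

namespace Tangled

variable (K : Type*) [Field K] (V : Type*) [AddCommGroup V] [Module K V]

/-- The ring `R = S^•(V*)` of polynomials on `V`. -/
abbrev PolyRing := SymmetricAlgebra K (Dual K V)

/-- The degree `k` part `R_k = S^k(V*)`: the span of the products of `k` linear forms. -/
def formsOfDegree (k : ℕ) : Submodule K (PolyRing K V) :=
  LinearMap.range (SymmetricAlgebra.ι K (Dual K V)) ^ k

variable {K V}

/-- Evaluation of polynomials at the point `ψ`. -/
def evalAt (ψ : V) : PolyRing K V →ₐ[K] K :=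
  SymmetricAlgebra.lift (Dual.eval K V ψ)

/-- An ideal is homogeneous if it is generated by homogeneous polynomials. -/
def IsHomogeneousIdeal (I : Ideal (PolyRing K V)) : Prop :=
  ∃ S : Set (PolyRing K V), (∀ f ∈ S, ∃ d, f ∈ formsOfDegree K V d) ∧ I = Ideal.span S

/-- The degree `k` component `I_k` of an ideal. -/
def idealPart (I : Ideal (PolyRing K V)) (k : ℕ) : Submodule K (PolyRing K V) :=
  I.restrictScalars K ⊓ formsOfDegree K V k

/-- The ideal `I(U)` of all polynomials that vanish on the subspace `U`. -/
def idealOfSubspace (U : Submodule K V) : Ideal (PolyRing K V) :=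
  ⨅ ψ ∈ U, RingHom.ker (evalAt ψ)

/-- The projective zero locus `V(I)`; for a homogeneous ideal the condition does not depend on the
chosen representative of the point. -/
def zeroLocus (I : Ideal (PolyRing K V)) : Set (ℙ K V) :=
  {p | ∀ f ∈ I, evalAt p.rep f = 0}

/-- `U` is `X`-tangled if no point of `X` lies in (the projectivization of) `U`. -/
def IsTangled (X : Set (ℙ K V)) (U : Submodule K V) : Prop :=
  {p : ℙ K V | p.submodule ≤ U} ∩ X = ∅

/-! ### Tensors -/

variable (K V) in
/-- The symmetric tensors `S^k(V) ⊆ V^{⊗k}`. -/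
def symTensors (k : ℕ) : Submodule K (⨂[K] _ : Fin k, V) :=
  ⨅ σ : Equiv.Perm (Fin k),
    LinearMap.eqLocus (PiTensorProduct.reindex K (fun _ : Fin k => V) σ).toLinearMap
      LinearMap.id

variable (K V) in
/-- The canonical map `(V*)^{⊗k} → S^•(V*)` sending `ℓ₁ ⊗ ⋯ ⊗ ℓ_k` to `ℓ₁ ⋯ ℓ_k`. -/
def tensorToForm (k : ℕ) : (⨂[K] _ : Fin k, Dual K V) →ₗ[K] PolyRing K V :=
  PiTensorProduct.lift
    ((MultilinearMap.mkPiAlgebra K (Fin k) (PolyRing K V)).compLinearMap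
      fun _ => SymmetricAlgebra.ι K (Dual K V))

/-- The orthogonal complement `I_k^⊥ ⊆ S^k(V)` of `I_k ⊆ S^k(V*)`. A form `f` of degree `k` is
paired with a symmetric tensor `t` by pairing `t` with any tensor `F` in `(V*)^{⊗k}` that
represents `f`; as `t` is symmetric, the value does not depend on `F`. -/
def idealPerp (I : Ideal (PolyRing K V)) (k : ℕ) : Submodule K (⨂[K] _ : Fin k, V) where
  carrier := {t | t ∈ symTensors K V k ∧ ∀ F : ⨂[K] _ : Fin k, Dual K V,
    tensorToForm K V k F ∈ idealPart I k → PiTensorProduct.dualDistrib F t = 0}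
  zero_mem' := ⟨zero_mem _, fun _ _ => map_zero _⟩
  add_mem' := fun ha hb =>
    ⟨add_mem ha.1 hb.1, fun F hF => by rw [map_add, ha.2 F hF, hb.2 F hF, add_zero]⟩
  smul_mem' := fun c _ ha =>
    ⟨Submodule.smul_mem _ c ha.1, fun F hF => by rw [map_smul, ha.2 F hF, smul_zero]⟩

/-- The tensor power `U^{⊗k}`, as a subspace of `V^{⊗k}`. -/
def tensorPowerOf (U : Submodule K V) (k : ℕ) : Submodule K (⨂[K] _ : Fin k, V) :=
  LinearMap.range (PiTensorProduct.map fun _ : Fin k => U.subtype)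

/-- `X^k`, the span of the tensor powers `ψ^{⊗k}` of the points of `X`. -/
def varietyPower (X : Set (ℙ K V)) (k : ℕ) : Submodule K (⨂[K] _ : Fin k, V) :=
  Submodule.span K
    {t | ∃ (ψ : V) (hψ : ψ ≠ 0), Projectivization.mk K ψ hψ ∈ X ∧
      t = PiTensorProduct.tprod K fun _ : Fin k => ψ}

/-! ### The Zariski topology and the Grassmannian -/

variable (K V) in
/-- The Zariski topology on projective space: the closed sets are the projective varieties. -/
abbrev projectiveZariski : TopologicalSpace (ℙ K V) :=
  TopologicalSpace.ofClosed
    {Z | ∃ J : Ideal (PolyRing K V), IsHomogeneousIdeal J ∧ Z = zeroLocus J}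
    (by
      refine ⟨⊤, ⟨{1}, ?_, (Ideal.span_singleton_one).symm⟩, ?_⟩
      · rintro f rfl
        exact ⟨0, by rw [formsOfDegree, pow_zero]; exact Submodule.one_le.mp le_rfl⟩
      · refine (Set.eq_empty_of_forall_notMem fun p hp => ?_).symm
        have := hp 1 Submodule.mem_top
        rw [map_one] at this
        exact one_ne_zero this)
    (by
      intro A hA
      have hA' : ∀ Z ∈ A, ∃ (J : Ideal (PolyRing K V)) (S : Set (PolyRing K V)),
          (∀ f ∈ S, ∃ d, f ∈ formsOfDegree K V d) ∧ J = Ideal.span S ∧ Z = zeroLocus J :=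
        fun Z h => by
          obtain ⟨J, ⟨S, hS, hJ⟩, hZ⟩ := hA h
          exact ⟨J, S, hS, hJ, hZ⟩
      choose! J S hS hJS hZ using hA'
      refine ⟨⨆ Z ∈ A, J Z, ⟨⋃ Z ∈ A, S Z, ?_, ?_⟩, ?_⟩
      · intro f hf
        simp only [Set.mem_iUnion] at hf
        obtain ⟨Z, hZA, hfZ⟩ := hf
        exact hS Z hZA f hfZ
      · rw [Ideal.span, Submodule.span_iUnion₂]
        exact iSup_congr fun Z => iSup_congr fun h => hJS Z h
      · ext p
        have key : p ∈ zeroLocus (⨆ Z ∈ A, J Z) ↔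
            (⨆ Z ∈ A, J Z) ≤ RingHom.ker (evalAt p.rep) := Iff.rfl
        rw [key, iSup₂_le_iff, Set.mem_sInter]
        refine forall_congr' fun Z => forall_congr' fun h => ?_
        conv_lhs => rw [hZ Z h]
        exact Iff.rfl)
    (by
      rintro _ ⟨I, ⟨S, hS, rfl⟩, rfl⟩ _ ⟨J, ⟨T, hT, rfl⟩, rfl⟩
      refine ⟨Ideal.span S * Ideal.span T, ⟨Set.image2 (· * ·) S T, ?_, Ideal.span_mul_span' S T⟩, ?_⟩
      · rintro _ ⟨f, hf, g, hg, rfl⟩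
        obtain ⟨a, ha⟩ := hS f hf
        obtain ⟨b, hb⟩ := hT g hg
        refine ⟨a + b, ?_⟩
        rw [formsOfDegree, pow_add]
        exact Submodule.mul_mem_mul ha hb
      · ext p
        have hp : (RingHom.ker (evalAt (K := K) p.rep)).IsPrime := RingHom.ker_isPrime _
        exact hp.mul_le.symm)

variable (K V) in
/-- The Grassmannian of `s`-dimensional subspaces of `V`. -/
def Grassmannian (s : ℕ) : Type _ := {U : Submodule K V // finrank K U = s}

variable [FiniteDimensional K V]

/-- The Plücker embedding: `U` is sent to the line `⋀^s U ⊆ ⋀^s V`, that is, to the point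
`[u₁ ∧ ⋯ ∧ u_s]` for any basis `u₁, …, u_s` of `U`. -/
def plucker {s : ℕ} (U : Grassmannian K V s) : ℙ K (⋀[K]^s V) :=
  Projectivization.mk'' (LinearMap.range (exteriorPower.map s U.1.subtype)) (by
    rw [LinearMap.finrank_range_of_inj
      (exteriorPower.map_injective_field U.1.subtype_injective),
      exteriorPower.finrank_eq, U.2, Nat.choose_self])

/-- The Zariski topology of the Grassmannian as a projective variety. -/
instance Grassmannian.instTopologicalSpace (s : ℕ) : TopologicalSpace (Grassmannian K V s) :=
  TopologicalSpace.induced plucker (projectiveZariski K (⋀[K]^s V))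

/-- A property holds for a generically chosen `s`-dimensional subspace of `V` if it holds on a
Zariski open dense subset of the Grassmannian. -/
def HoldsGenerically (s : ℕ) (P : Submodule K V → Prop) : Prop :=
  ∃ O : Set (Grassmannian K V s), IsOpen O ∧ Dense O ∧ ∀ U ∈ O, P U.1

end Tangled

end

/-! Everything is read in the dual of $R_k$. The pairing embeds this dual into $V^{\otimes k}$
(`dualFormToTensor`), carrying the annihilator of $I_k$ onto $I_k^\perp$ and the span of evaluations
at points of $\mathcal X$ onto $\mathcal X^k$. Let $T$ be either space of functionals. All the
conclusions follow once no nonzero $\tau\in T$ is killed by contraction with every linear form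
vanishing on $U$, since elements of $U^{\otimes k}$, evaluations at points of $U$ and functionals
killing $I(U)_k$ are all killed by these contractions.

The dimension bound enters in `exists_separating_linearForms`: if $\dim T<\binom{m+k}{k}$, some $m$
linear forms already separate $T$. Rank-nullity for contraction with $l$ splits $\dim T$ as Pascal's
rule splits the binomial, so either the kernel part or the image is small enough for induction on
$m$ or $k$.

With $m=N-s$, a subspace in the common kernel gives one good $U$. Separation is nonvanishing of a
determinant, and the forms vanishing on $U$ depend linearly on its Plücker vector
(`exists_wedgeForm_eq_iff`), so good subspaces contain a nonempty basic open set. Polynomial curves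
through frames make it dense (`dense_setOf_evalAt_ne_zero`). -/

noncomputable section

namespace Tangled

/-! ### Homogeneous forms and contraction of functionals. -/

section Forms

variable {K : Type*} [Field K] {V : Type*} [AddCommGroup V] [Module K V]

@[simp]
lemma evalAt_ι (ψ : V) (φ : Dual K V) :
    evalAt ψ (SymmetricAlgebra.ι K (Dual K V) φ) = φ ψ := by
  simp [evalAt]

lemma ι_mem_formsOfDegree_one (a : Dual K V) :
    SymmetricAlgebra.ι K (Dual K V) a ∈ formsOfDegree K V 1 := by
  rw [formsOfDegree, pow_one]
  exact ⟨a, rfl⟩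

lemma one_mem_formsOfDegree_zero : (1 : PolyRing K V) ∈ formsOfDegree K V 0 := by
  rw [formsOfDegree, pow_zero]
  exact Submodule.one_le.mp le_rfl

lemma mul_mem_formsOfDegree {d e : ℕ} {f g : PolyRing K V} (hf : f ∈ formsOfDegree K V d)
    (hg : g ∈ formsOfDegree K V e) : f * g ∈ formsOfDegree K V (d + e) := by
  rw [formsOfDegree, pow_add]
  exact Submodule.mul_mem_mul hf hg

lemma ι_mul_mem_formsOfDegree (a : Dual K V) {k : ℕ} {f : PolyRing K V}
    (hf : f ∈ formsOfDegree K V k) :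
    SymmetricAlgebra.ι K (Dual K V) a * f ∈ formsOfDegree K V (k + 1) := by
  rw [mul_comm]
  exact mul_mem_formsOfDegree hf (ι_mem_formsOfDegree_one a)

lemma prod_ι_mem_formsOfDegree {n : Type*} (S : Finset n) (φ : n → Dual K V) :
    ∏ i ∈ S, SymmetricAlgebra.ι K (Dual K V) (φ i) ∈ formsOfDegree K V S.card := by
  classical
  induction S using Finset.induction_on with
  | empty => exact one_mem_formsOfDegree_zero
  | insert i S hi ih =>
    rw [Finset.prod_insert hi, Finset.card_insert_of_notMem hi]
    exact ι_mul_mem_formsOfDegree _ ih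

lemma formsOfDegree_induction {k : ℕ} {p : PolyRing K V → Prop}
    (add : ∀ f g, p f → p g → p (f + g))
    (ι_mul : ∀ a, ∀ f ∈ formsOfDegree K V k, p (SymmetricAlgebra.ι K (Dual K V) a * f))
    {f : PolyRing K V} (hf : f ∈ formsOfDegree K V (k + 1)) : p f := by
  rw [formsOfDegree, pow_succ'] at hf
  refine Submodule.mul_induction_on hf ?_ add
  rintro _ ⟨a, rfl⟩ g hg
  exact ι_mul a g hg

/-- A form of degree `d` is homogeneous of degree `d` as a function. -/
lemma evalAt_smul {d : ℕ} {f : PolyRing K V} (hf : f ∈ formsOfDegree K V d) (c : K) (ψ : V) :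
    evalAt (c • ψ) f = c ^ d * evalAt ψ f := by
  induction d generalizing f with
  | zero =>
    rw [formsOfDegree, pow_zero, Submodule.mem_one] at hf
    obtain ⟨r, rfl⟩ := hf
    simp
  | succ d ih =>
    refine formsOfDegree_induction
      (p := fun f => evalAt (c • ψ) f = c ^ (d + 1) * evalAt ψ f)
      (fun f g hf hg => by rw [map_add, map_add, hf, hg, mul_add])
      (fun a g hg => ?_) hf
    rw [map_mul, map_mul, ih hg, evalAt_ι, evalAt_ι, map_smul, smul_eq_mul]
    ring

instance [FiniteDimensional K V] (k : ℕ) : Module.Finite K (formsOfDegree K V k) :=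
  Module.Finite.iff_fg.mpr
    (Submodule.FG.pow (Module.Finite.iff_fg.mp (inferInstanceAs (Module.Finite K
      (LinearMap.range (SymmetricAlgebra.ι K (Dual K V)))))) k)

/-- Multiplication of forms by linear forms. -/
def mulForm (k : ℕ) :
    Dual K V →ₗ[K] formsOfDegree K V k →ₗ[K] formsOfDegree K V (k + 1) :=
  LinearMap.mk₂ K
    (fun a f => ⟨SymmetricAlgebra.ι K (Dual K V) a * f, ι_mul_mem_formsOfDegree a f.2⟩)
    (fun a b f => Subtype.ext (by simp [add_mul]))
    (fun c a f => Subtype.ext (by simp))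
    (fun a f g => Subtype.ext (by simp [mul_add]))
    (fun c a f => Subtype.ext (by simp))

@[simp]
lemma mulForm_coe (k : ℕ) (a : Dual K V) (f : formsOfDegree K V k) :
    (mulForm k a f : PolyRing K V) = SymmetricAlgebra.ι K (Dual K V) a * f := rfl

lemma mulForm_comm (k : ℕ) (a b : Dual K V) (f : formsOfDegree K V k) :
    mulForm (k + 1) a (mulForm k b f) = mulForm (k + 1) b (mulForm k a f) :=
  Subtype.ext (by simp [mul_left_comm])

/-- The contraction of a functional on forms of degree `k` with a linear form. -/
def contract : ∀ k : ℕ, Dual K V →ₗ[K]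
    Dual K (formsOfDegree K V k) →ₗ[K] Dual K (formsOfDegree K V (k - 1))
  | 0 => 0
  | k + 1 => LinearMap.mk₂ K (fun a τ => τ ∘ₗ mulForm k a)
      (fun a b τ => LinearMap.ext fun f => by simp)
      (fun c a τ => LinearMap.ext fun f => by simp)
      (fun a τ τ' => LinearMap.ext fun f => by simp)
      (fun c a τ => LinearMap.ext fun f => by simp)

lemma contract_succ_eq_zero_iff {k : ℕ} {a : Dual K V}
    {τ : Dual K (formsOfDegree K V (k + 1))} :
    contract (k + 1) a τ = 0 ↔ ∀ f, τ (mulForm k a f) = 0 :=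
  LinearMap.ext_iff

lemma contract_comm (k : ℕ) (a b : Dual K V) (τ : Dual K (formsOfDegree K V k)) :
    contract (k - 1) a (contract k b τ) = contract (k - 1) b (contract k a τ) := by
  match k with
  | 0 => rfl
  | 1 => rfl
  | k + 2 =>
    ext f
    change τ (mulForm (k + 1) b (mulForm k a f)) = τ (mulForm (k + 1) a (mulForm k b f))
    rw [mulForm_comm]

/-- Products of a linear form with a form of degree `k` span the forms of degree `k + 1`. -/
lemma eq_zero_of_contract_eq_zero {k : ℕ} {τ : Dual K (formsOfDegree K V (k + 1))}
    (h : ∀ a, contract (k + 1) a τ = 0) : τ = 0 := by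
  have key : ∀ f (hf : f ∈ formsOfDegree K V (k + 1)), τ ⟨f, hf⟩ = 0 := by
    intro f hf
    have : ∃ hf : f ∈ formsOfDegree K V (k + 1), τ ⟨f, hf⟩ = 0 := by
      refine formsOfDegree_induction (p := fun f => ∃ hf : f ∈ formsOfDegree K V (k + 1),
        τ ⟨f, hf⟩ = 0) ?_ ?_ hf
      · rintro f g ⟨hf, h1⟩ ⟨hg, h2⟩
        refine ⟨add_mem hf hg, ?_⟩
        have := map_add τ ⟨f, hf⟩ ⟨g, hg⟩
        rwa [h1, h2, add_zero] at this
      · intro a f hf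
        exact ⟨ι_mul_mem_formsOfDegree a hf, contract_succ_eq_zero_iff.mp (h a) ⟨f, hf⟩⟩
    exact this.2
  exact LinearMap.ext fun f => key f.1 f.2

end Forms

/-! ### Nonvanishing of polynomials over an infinite field. -/

section Nonvanishing

variable {K : Type*} [Field K] {E : Type*} [AddCommGroup E] [Module K E]

/-- A curve is polynomial if its coordinates are polynomials in the parameter. -/
def IsPolynomialCurve (P : K → E) : Prop :=
  ∀ φ : Dual K E, ∃ p : Polynomial K, ∀ t, p.eval t = φ (P t)

lemma isPolynomialCurve_line (x y : E) : IsPolynomialCurve fun t : K => x + t • y :=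
  fun φ => ⟨Polynomial.C (φ x) + Polynomial.X * Polynomial.C (φ y), fun t => by
    rw [map_add, map_smul, smul_eq_mul]
    simp only [Polynomial.eval_add, Polynomial.eval_C, Polynomial.eval_mul, Polynomial.eval_X]⟩

lemma IsPolynomialCurve.exists_eval_eq {P : K → E} (hP : IsPolynomialCurve P)
    (f : PolyRing K E) : ∃ p : Polynomial K, ∀ t, p.eval t = evalAt (P t) f := by
  induction f using SymmetricAlgebra.induction with
  | algebraMap r => exact ⟨Polynomial.C r, fun t => by simp⟩
  | ι φ =>
    obtain ⟨p, hp⟩ := hP φ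
    exact ⟨p, fun t => by rw [hp, evalAt_ι]⟩
  | mul f g hf hg =>
    obtain ⟨p, hp⟩ := hf
    obtain ⟨q, hq⟩ := hg
    exact ⟨p * q, fun t => by simp [hp, hq]⟩
  | add f g hf hg =>
    obtain ⟨p, hp⟩ := hf
    obtain ⟨q, hq⟩ := hg
    exact ⟨p + q, fun t => by simp [hp, hq]⟩

/-- Both restrictions to the curve are nonzero one-variable polynomials; so is their product, and it
cannot vanish at every point of an infinite field. This yields irreducibility of whatever such
curves connect. -/
lemma IsPolynomialCurve.exists_evalAt_mul_ne_zero [Infinite K] {P : K → E}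
    (hP : IsPolynomialCurve P) {f g : PolyRing K E} {t₁ t₂ : K}
    (hf : evalAt (P t₁) f ≠ 0) (hg : evalAt (P t₂) g ≠ 0) : ∃ t, evalAt (P t) (f * g) ≠ 0 := by
  obtain ⟨p, hp⟩ := hP.exists_eval_eq f
  obtain ⟨q, hq⟩ := hP.exists_eval_eq g
  have hp0 : p ≠ 0 := by
    rintro rfl
    exact hf (by rw [← hp]; simp)
  have hq0 : q ≠ 0 := by
    rintro rfl
    exact hg (by rw [← hq]; simp)
  by_contra! h
  refine mul_ne_zero hp0 hq0 (Polynomial.funext fun t => ?_)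
  rw [Polynomial.eval_mul, hp, hq, ← map_mul, h, Polynomial.eval_zero]

lemma exists_forall_evalAt_ne_zero [Infinite K] {ι : Type*} (S : Finset ι)
    (f : ι → PolyRing K E) (h : ∀ i ∈ S, ∃ x, evalAt x (f i) ≠ 0) :
    ∃ x, ∀ i ∈ S, evalAt x (f i) ≠ 0 := by
  classical
  suffices ∃ x, evalAt x (∏ i ∈ S, f i) ≠ 0 by
    simpa [map_prod, Finset.prod_ne_zero_iff] using this
  induction S using Finset.induction_on with
  | empty => exact ⟨0, by simp⟩
  | insert i S hi ih =>
    obtain ⟨x, hx⟩ := h i (Finset.mem_insert_self i S)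
    obtain ⟨y, hy⟩ := ih fun j hj => h j (Finset.mem_insert_of_mem hj)
    obtain ⟨t, ht⟩ := (isPolynomialCurve_line (K := K) x (y - x)).exists_evalAt_mul_ne_zero
      (t₁ := 0) (t₂ := 1) (f := f i) (g := ∏ j ∈ S, f j)
      (by rwa [zero_smul, add_zero]) (by rwa [one_smul, add_sub_cancel])
    exact ⟨_, by rwa [Finset.prod_insert hi]⟩

/-- Injectivity of a linear map that depends linearly on a parameter is an open condition. -/
lemma exists_form_of_injective {T F : Type*} [AddCommGroup T] [Module K T]
    [FiniteDimensional K T] [AddCommGroup F] [Module K F] (Ψ : E →ₗ[K] T →ₗ[K] F) {x₀ : E}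
    (h : Function.Injective (Ψ x₀)) :
    ∃ d, ∃ f ∈ formsOfDegree K E d, evalAt x₀ f ≠ 0 ∧
      ∀ x, evalAt x f ≠ 0 → Function.Injective (Ψ x) := by
  classical
  -- With $L$ fixed, $\det(L\circ\Psi_x)$ is a form in $x$ of degree $\dim T$, equal to $1$ at
  -- $x_0$; where it is nonzero, $\Psi_x$ is injective.
  obtain ⟨L, hL⟩ := LinearMap.exists_leftInverse_of_injective (Ψ x₀) (LinearMap.ker_eq_bot.mpr h)
  let b := Module.finBasis K T
  let φ : Fin (finrank K T) → Fin (finrank K T) → Dual K E := fun i j =>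
    b.coord i ∘ₗ L ∘ₗ Ψ.flip (b j)
  let f : PolyRing K E := (Matrix.of fun i j => SymmetricAlgebra.ι K (Dual K E) (φ i j)).det
  have hf : ∀ x, evalAt x f = LinearMap.det (L ∘ₗ Ψ x) := by
    intro x
    rw [← LinearMap.det_toMatrix b, AlgHom.map_det]
    congr 1
    ext i j
    simp [φ, LinearMap.toMatrix_apply]
  refine ⟨(Finset.univ : Finset (Fin (finrank K T))).card, f, ?_, ?_, fun x hx => ?_⟩
  · change Matrix.det _ ∈ _
    rw [Matrix.det_apply]
    refine Submodule.sum_mem _ fun σ _ => ?_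
    rw [Units.smul_def]
    exact zsmul_mem (prod_ι_mem_formsOfDegree _ fun i => φ (σ i) i) _
  · rw [hf, hL, LinearMap.det_id]
    exact one_ne_zero
  · rw [hf] at hx
    have := (LinearMap.equivOfDetNeZero _ hx).injective
    exact Function.Injective.of_comp (f := L) this

/-- The separation property of a family of vectors depending linearly on a parameter is an open
condition. -/
lemma exists_form_of_separating {J D M M' : Type*} [AddCommGroup D] [Module K D]
    [AddCommGroup M] [Module K M] [AddCommGroup M'] [Module K M'] (B : J → E →ₗ[K] D)
    (C : D →ₗ[K] M →ₗ[K] M') (T : Submodule K M) [FiniteDimensional K T] {x₀ : E}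
    (h : ∀ τ ∈ T, (∀ j, C (B j x₀) τ = 0) → τ = 0) :
    ∃ d, ∃ f ∈ formsOfDegree K E d, evalAt x₀ f ≠ 0 ∧
      ∀ x, evalAt x f ≠ 0 → ∀ τ ∈ T, (∀ j, C (B j x) τ = 0) → τ = 0 := by
  let Ψ : E →ₗ[K] T →ₗ[K] (J → M') := LinearMap.mk₂ K (fun x τ j => C (B j x) τ)
    (fun _ _ _ => funext fun _ => by simp) (fun _ _ _ => funext fun _ => by simp)
    (fun _ _ _ => funext fun _ => by simp) (fun _ _ _ => funext fun _ => by simp)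
  have hΨ : ∀ x, Function.Injective (Ψ x) ↔ ∀ τ ∈ T, (∀ j, C (B j x) τ = 0) → τ = 0 := by
    intro x
    rw [injective_iff_map_eq_zero]
    constructor
    · intro h τ hτ h0
      exact congrArg Subtype.val (h ⟨τ, hτ⟩ (funext h0))
    · intro h τ hτ
      exact Subtype.ext (h τ τ.2 fun i => congrFun hτ i)
  obtain ⟨d, f, hfd, hf, hf'⟩ := exists_form_of_injective Ψ ((hΨ x₀).mpr h)
  exact ⟨d, f, hfd, hf, fun x hx => (hΨ x).mp (hf' x hx)⟩

end Nonvanishing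

/-! ### Separation by few linear forms. -/

section Core

lemma finrank_map_add_finrank_inf_ker {K M B : Type*} [Field K] [AddCommGroup M] [Module K M]
    [FiniteDimensional K M] [AddCommGroup B] [Module K B] (T : Submodule K M) (c : M →ₗ[K] B) :
    finrank K (T.map c) + finrank K (T ⊓ LinearMap.ker c : Submodule K M) = finrank K T := by
  have h := LinearMap.finrank_range_add_finrank_ker (c.domRestrict T)
  rwa [LinearMap.range_domRestrict, LinearMap.ker_domRestrict, ← Submodule.finrank_map_subtype_eq,
    Submodule.map_comap_subtype] at h

variable {K : Type*} [Field K] {V : Type*} [AddCommGroup V] [Module K V] [FiniteDimensional K V]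

/-- A set of functionals on the forms of degree `k` that has dimension less than
`binom (m + k) k` contains no nonzero element killed by `m` suitable linear forms. -/
theorem exists_separating_linearForms [Infinite K] (k m : ℕ)
    (T : Submodule K (Dual K (formsOfDegree K V k))) (hT : finrank K T < (m + k).choose k) :
    ∃ a : Fin m → Dual K V, ∀ τ ∈ T, (∀ i, contract k (a i) τ = 0) → τ = 0 := by
  induction k generalizing m with
  | zero =>
    -- Contraction in degree 0 is zero by definition, so separation means $T=0$; the bound $\dim
    -- T<1$ gives exactly this.
    have : T = ⊥ := by
      rw [← Submodule.finrank_eq_zero (R := K)]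
      simpa using hT
    exact ⟨0, fun τ hτ _ => by simpa [this] using hτ⟩
  | succ k ihk =>
    induction m generalizing T with
    | zero =>
      have : T = ⊥ := by
        rw [← Submodule.finrank_eq_zero (R := K)]
        simpa using hT
      exact ⟨0, fun τ hτ _ => by simpa [this] using hτ⟩
    | succ m ihm =>
      have hdim := fun l => finrank_map_add_finrank_inf_ker T (contract (k + 1) l)
      have hpascal : (m + 1 + (k + 1)).choose (k + 1) =
          (m + 1 + k).choose k + (m + (k + 1)).choose (k + 1) := by
        rw [← add_assoc, Nat.choose_succ_succ]
        congr 2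
        omega
      -- If some kernel part is small, `l` serves as one of the forms and `m` others separate what
      -- it kills. Otherwise every image under contraction is below the other Pascal term, and
      -- induction on the degree applies for every `l`.
      by_cases hl : ∃ l, finrank K (T ⊓ LinearMap.ker (contract (k + 1) l) : Submodule K _) <
          (m + (k + 1)).choose (k + 1)
      · obtain ⟨l, hl⟩ := hl
        obtain ⟨a, ha⟩ := ihm _ hl
        exact ⟨Fin.cons l a, fun τ hτ h => ha τ ⟨hτ, h 0⟩ fun i => h i.succ⟩
      · push Not at hl
        have hgen : ∀ l, ∃ f : PolyRing K (Fin (m + 1) → Dual K V), (∃ a, evalAt a f ≠ 0) ∧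
            ∀ a, evalAt a f ≠ 0 → ∀ τ ∈ T.map (contract (k + 1) l),
              (∀ i, contract k (a i) τ = 0) → τ = 0 := by
          intro l
          obtain ⟨a, ha⟩ := ihk (m + 1) (T.map (contract (k + 1) l)) (by
            have h1 := hdim l
            have h2 := hl l
            change finrank K (T.map (contract (k + 1) l)) + _ = _ at h1
            rw [hpascal] at hT
            by_contra! h3
            exact absurd (h1 ▸ hT) (not_lt.mpr (Nat.add_le_add h3 h2)))
          obtain ⟨_, f, -, hf, hf'⟩ := exists_form_of_separating
            (LinearMap.proj (R := K) (φ := fun _ : Fin (m + 1) => Dual K V)) (contract k)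
            (T.map (contract (k + 1) l)) ha
          exact ⟨f, ⟨a, hf⟩, hf'⟩
        choose f hf hf' using hgen
        -- Contraction is linear in the form, so one tuple that is good for the finitely many basis
        -- forms suffices.
        let b := Module.finBasis K (Dual K V)
        obtain ⟨a, ha⟩ := exists_forall_evalAt_ne_zero Finset.univ (fun i => f (b i))
          fun i _ => hf (b i)
        refine ⟨a, fun τ hτ h => eq_zero_of_contract_eq_zero fun l => ?_⟩
        have hb : ∀ i, contract (k + 1) (b i) τ = 0 := fun i =>
          hf' (b i) a (ha i (Finset.mem_univ i)) _ ⟨τ, hτ, rfl⟩ fun j => by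
            change contract (k + 1 - 1) (a j) (contract (k + 1) (b i) τ) = 0
            -- Contractions commute, so whatever the tuple kills in `τ` it also kills in each
            -- contraction of `τ`.
            rw [contract_comm, h j, map_zero]
        have : (contract (k + 1)).flip τ = 0 := b.ext fun i => by
          rw [LinearMap.flip_apply, hb i, LinearMap.zero_apply]
        exact LinearMap.congr_fun this l

end Core

/-! ### Decomposable vectors in the exterior power. -/

section Wedge

variable {K : Type*} [Field K] {V : Type*} [AddCommGroup V] [Module K V]

lemma ιMulti_ne_zero {n : ℕ} {u : Fin n → V} (hu : LinearIndependent K u) :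
    exteriorPower.ιMulti K n u ≠ 0 := by
  let S : Set.powersetCard (Fin n) n := Set.powersetCard.ofFinEmbEquiv (RelEmbedding.refl _)
  have h := (exteriorPower.ιMulti_family_linearIndependent_field (n := n) hu).ne_zero S
  rwa [exteriorPower.ιMulti_family, Equiv.symm_apply_apply] at h

lemma ιMulti_ne_zero_iff {n : ℕ} {u : Fin n → V} :
    exteriorPower.ιMulti K n u ≠ 0 ↔ LinearIndependent K u :=
  ⟨fun h => by_contra fun hu => h (AlternatingMap.map_linearDependent _ _ hu), ιMulti_ne_zero⟩

/-- The product is the wedge of the tuple extended by `x`, which vanishes exactly when that tuple is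
dependent. Thus the Plücker vector determines the subspace. -/
lemma ι_mul_ιMulti_eq_zero_iff {n : ℕ} {u : Fin n → V} (hu : LinearIndependent K u) (x : V) :
    ExteriorAlgebra.ι K x * (exteriorPower.ιMulti K n u : ExteriorAlgebra K V) = 0 ↔
      x ∈ Submodule.span K (Set.range u) := by
  have h : ExteriorAlgebra.ι K x * (exteriorPower.ιMulti K n u : ExteriorAlgebra K V) =
      (exteriorPower.ιMulti K (n + 1) (Fin.cons x u) : ExteriorAlgebra K V) := by
    rw [exteriorPower.ιMulti_apply_coe, exteriorPower.ιMulti_apply_coe,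
      ExteriorAlgebra.ιMulti_succ_apply]
    rfl
  rw [h, Submodule.coe_eq_zero, ← not_iff_not, ← ne_eq, ιMulti_ne_zero_iff,
    linearIndependent_finCons]
  exact and_iff_right hu

/-- The linear forms `x ↦ θ (x ∧ ω)`, as linear functions of `ω`. -/
def wedgeForm (n : ℕ) (θ : Dual K (ExteriorAlgebra K V)) : ⋀[K]^n V →ₗ[K] Dual K V :=
  LinearMap.mk₂ K (fun ω x => θ (ExteriorAlgebra.ι K x * (ω : ExteriorAlgebra K V)))
    (fun _ _ _ => by rw [Submodule.coe_add, mul_add, map_add])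
    (fun _ _ _ => by rw [Submodule.coe_smul, mul_smul_comm, map_smul])
    (fun _ _ _ => by rw [map_add, add_mul, map_add])
    (fun _ _ _ => by rw [map_smul, smul_mul_assoc, map_smul])

/-- A functional factors through $x\mapsto x\wedge\omega$ iff it kills the kernel, which is the
span. The forms vanishing on a subspace are thus parametrized linearly in its Plücker vector. -/
lemma exists_wedgeForm_eq_iff {n : ℕ} {u : Fin n → V} (hu : LinearIndependent K u)
    (a : Dual K V) :
    (∃ θ, wedgeForm n θ (exteriorPower.ιMulti K n u) = a) ↔
      a ∈ (Submodule.span K (Set.range u)).dualAnnihilator := by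
  let g : V →ₗ[K] ExteriorAlgebra K V := LinearMap.mulRight K
    (exteriorPower.ιMulti K n u : ExteriorAlgebra K V) ∘ₗ ExteriorAlgebra.ι K
  have hg : LinearMap.ker g = Submodule.span K (Set.range u) :=
    Submodule.ext fun x => ι_mul_ιMulti_eq_zero_iff hu x
  rw [← hg, ← LinearMap.range_dualMap_eq_dualAnnihilator_ker]
  rfl

lemma isPolynomialCurve_ιMulti {n : ℕ} (u w : Fin n → V) :
    IsPolynomialCurve fun t : K => exteriorPower.ιMulti K n (u + t • w) := by
  classical
  intro φ
  -- Multilinear expansion: `S` is the set of slots that take `t • w`, contributing $t^{|S|}$.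
  refine ⟨∑ S : Finset (Fin n), Polynomial.C (φ (exteriorPower.ιMulti K n (S.piecewise w u))) *
    Polynomial.X ^ S.card, fun t => ?_⟩
  change _ = φ (exteriorPower.ιMulti K n (u + t • w))
  rw [add_comm u, AlternatingMap.map_add_univ, map_sum, Polynomial.eval_finsetSum]
  refine Finset.sum_congr rfl fun S _ => ?_
  have h : S.piecewise (t • w) u =
      S.piecewise (fun i => (if i ∈ S then t else 1) • S.piecewise w u i) (S.piecewise w u) := by
    ext i
    by_cases hi : i ∈ S <;> simp [hi]
  have h2 := (exteriorPower.ιMulti K n (M := V)).toMultilinearMap.map_piecewise_smul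
    (fun i => if i ∈ S then t else 1) (S.piecewise w u) S
  rw [h]
  refine Eq.trans ?_ (congrArg φ h2).symm
  rw [map_smul, Finset.prod_congr rfl (fun i hi => if_pos hi), Finset.prod_const,
    smul_eq_mul, Polynomial.eval_mul, Polynomial.eval_C, Polynomial.eval_pow, Polynomial.eval_X,
    mul_comm]
  rfl

end Wedge

/-! ### Open and dense subsets of the Grassmannian. -/

section Grassmannian

variable {K : Type*} [Field K] {V : Type*} [AddCommGroup V] [Module K V] [FiniteDimensional K V]

/-- The point of the Grassmannian spanned by an independent tuple. -/
def Grassmannian.ofLinearIndependent {s : ℕ} {u : Fin s → V} (hu : LinearIndependent K u) :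
    Grassmannian K V s :=
  ⟨Submodule.span K (Set.range u), by rw [finrank_span_eq_card hu, Fintype.card_fin]⟩

lemma Grassmannian.exists_eq_ofLinearIndependent {s : ℕ} (U : Grassmannian K V s) :
    ∃ (u : Fin s → V) (hu : LinearIndependent K u), U = ofLinearIndependent hu := by
  let b := Module.finBasisOfFinrankEq K U.1 U.2
  have hu : LinearIndependent K (U.1.subtype ∘ b) :=
    b.linearIndependent.map' _ (Submodule.ker_subtype _)
  refine ⟨_, hu, Subtype.ext ?_⟩
  change U.1 = Submodule.span K (Set.range (U.1.subtype ∘ b))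
  rw [Set.range_comp, ← Submodule.map_span, b.span_eq, Submodule.map_top, Submodule.range_subtype]

lemma exists_plucker_rep_eq {s : ℕ} {u : Fin s → V} (hu : LinearIndependent K u) :
    ∃ c : K, c ≠ 0 ∧ (plucker (Grassmannian.ofLinearIndependent hu)).rep =
      c • exteriorPower.ιMulti K s u := by
  have hmem : exteriorPower.ιMulti K s u ∈
      (plucker (Grassmannian.ofLinearIndependent hu)).submodule := by
    rw [plucker, Projectivization.submodule_mk'']
    refine ⟨exteriorPower.ιMulti K s fun i => ⟨u i, Submodule.subset_span ⟨i, rfl⟩⟩, ?_⟩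
    rw [exteriorPower.map_apply_ιMulti]
    rfl
  rw [Projectivization.submodule_eq, Submodule.mem_span_singleton] at hmem
  obtain ⟨c, hc⟩ := hmem
  have hc0 : c ≠ 0 := by
    rintro rfl
    exact ιMulti_ne_zero hu (by rw [← hc, zero_smul])
  exact ⟨c⁻¹, inv_ne_zero hc0, by rw [← hc, inv_smul_smul₀ hc0]⟩

lemma evalAt_plucker_rep_ne_zero_iff {s d : ℕ} {f : PolyRing K (⋀[K]^s V)}
    (hf : f ∈ formsOfDegree K _ d) {u : Fin s → V} (hu : LinearIndependent K u) :
    evalAt (plucker (Grassmannian.ofLinearIndependent hu)).rep f ≠ 0 ↔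
      evalAt (exteriorPower.ιMulti K s u) f ≠ 0 := by
  obtain ⟨c, hc, h⟩ := exists_plucker_rep_eq hu
  rw [h, evalAt_smul hf, mul_ne_zero_iff]
  exact and_iff_right (pow_ne_zero d hc)

lemma isOpen_setOf_evalAt_ne_zero {s d : ℕ} {f : PolyRing K (⋀[K]^s V)}
    (hf : f ∈ formsOfDegree K _ d) :
    IsOpen {U : Grassmannian K V s | evalAt (plucker U).rep f ≠ 0} := by
  refine (@isOpen_induced_iff _ _ (projectiveZariski K (⋀[K]^s V)) _ _).mpr ⟨(zeroLocus (Ideal.span {f}))ᶜ, ?_, ?_⟩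
  · exact ⟨Ideal.span {f}, ⟨{f}, by rintro _ rfl; exact ⟨d, hf⟩, rfl⟩, compl_compl _⟩
  · ext U
    have : plucker U ∈ zeroLocus (Ideal.span {f}) ↔
        Ideal.span {f} ≤ RingHom.ker (evalAt (plucker U).rep) := Iff.rfl
    rw [Set.mem_preimage, Set.mem_compl_iff, this, Ideal.span_singleton_le_iff_mem]
    rfl

lemma exists_form_of_mem_isOpen {s : ℕ} {O : Set (Grassmannian K V s)} (hO : IsOpen O)
    {U : Grassmannian K V s} (hU : U ∈ O) :
    ∃ d, ∃ f ∈ formsOfDegree K (⋀[K]^s V) d, evalAt (plucker U).rep f ≠ 0 ∧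
      ∀ U' : Grassmannian K V s, evalAt (plucker U').rep f ≠ 0 → U' ∈ O := by
  obtain ⟨t, ⟨J, ⟨S, hS, rfl⟩, hJ⟩, rfl⟩ :=
    (@isOpen_induced_iff _ _ (projectiveZariski K (⋀[K]^s V)) _ _).mp hO
  have hmem : ∀ U' : Grassmannian K V s, plucker U' ∉ t ↔
      ∀ f ∈ S, evalAt (plucker U').rep f = 0 := by
    intro U'
    rw [← Set.mem_compl_iff, hJ]
    exact Ideal.span_le (I := RingHom.ker (evalAt (K := K) (plucker U').rep))
  have h := (hmem U).not.mp (not_not.mpr hU)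
  push Not at h
  obtain ⟨f, hfS, hf⟩ := h
  obtain ⟨d, hd⟩ := hS f hfS
  exact ⟨d, f, hd, hf, fun U' h' => by_contra fun h0 => h' ((hmem U').mp h0 f hfS)⟩

lemma dense_setOf_evalAt_ne_zero [Infinite K] {s d : ℕ} {f : PolyRing K (⋀[K]^s V)}
    (hf : f ∈ formsOfDegree K _ d) {U₀ : Grassmannian K V s}
    (hU₀ : evalAt (plucker U₀).rep f ≠ 0) :
    Dense {U : Grassmannian K V s | evalAt (plucker U).rep f ≠ 0} := by
  rw [dense_iff_inter_open]
  rintro O hO ⟨U₁, hU₁⟩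
  obtain ⟨e, g, hg, hgU₁, hgO⟩ := exists_form_of_mem_isOpen hO hU₁
  obtain ⟨u, hu, rfl⟩ := U₀.exists_eq_ofLinearIndependent
  obtain ⟨w, hw, rfl⟩ := U₁.exists_eq_ofLinearIndependent
  rw [evalAt_plucker_rep_ne_zero_iff hf] at hU₀
  rw [evalAt_plucker_rep_ne_zero_iff hg] at hgU₁
  -- The extra factor `φ` keeps the wedge nonzero at the chosen `t`, so the interpolated tuple stays
  -- independent.
  obtain ⟨φ, hφ⟩ := not_forall.mp
    ((Module.forall_dual_apply_eq_zero_iff K _).not.mpr (ιMulti_ne_zero hw))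
  obtain ⟨t, ht⟩ := (isPolynomialCurve_ιMulti (K := K) u (w - u)).exists_evalAt_mul_ne_zero
    (t₁ := 0) (t₂ := 1) (f := f) (g := g * SymmetricAlgebra.ι K _ φ)
    (by rwa [zero_smul, add_zero])
    (by
      rw [one_smul, add_sub_cancel, map_mul, evalAt_ι]
      exact mul_ne_zero hgU₁ hφ)
  rw [map_mul, map_mul, evalAt_ι] at ht
  have hv : LinearIndependent K (u + t • (w - u)) :=
    ιMulti_ne_zero_iff.mp fun h0 => ht (by rw [h0, map_zero, mul_zero, mul_zero])
  refine ⟨Grassmannian.ofLinearIndependent hv, hgO _ ?_, ?_⟩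
  · rw [evalAt_plucker_rep_ne_zero_iff hg]
    exact left_ne_zero_of_mul (right_ne_zero_of_mul ht)
  · exact (evalAt_plucker_rep_ne_zero_iff hf hv).mpr (left_ne_zero_of_mul ht)

lemma HoldsGenerically.mono {s : ℕ} {P Q : Submodule K V → Prop} (h : HoldsGenerically s P)
    (hPQ : ∀ U, P U → Q U) : HoldsGenerically s Q := by
  obtain ⟨O, hO, hd, hP⟩ := h
  exact ⟨O, hO, hd, fun U hU => hPQ _ (hP U hU)⟩

/-- A space of functionals on the forms of degree `k` that has dimension less than
`binom (N - s + k) k` contains no nonzero element killed by the linear forms that vanish on a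
generic `s`-dimensional subspace. -/
theorem holdsGenerically_separating [Infinite K] {s k : ℕ} (hs : s ≤ finrank K V)
    (T : Submodule K (Dual K (formsOfDegree K V k)))
    (hT : finrank K T < (finrank K V - s + k).choose k) :
    HoldsGenerically s fun U : Submodule K V =>
      ∀ τ ∈ T, (∀ a ∈ U.dualAnnihilator, contract k a τ = 0) → τ = 0 := by
  obtain ⟨a, ha⟩ := exists_separating_linearForms k _ T hT
  -- The $N-s$ forms have a common kernel of dimension at least $s$; any $s$-dimensional subspace of
  -- it is a good one.
  have hker : s ≤ finrank K (LinearMap.ker (LinearMap.pi a)) := by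
    have h1 := LinearMap.finrank_range_add_finrank_ker (LinearMap.pi a)
    have h2 := Submodule.finrank_le (LinearMap.range (LinearMap.pi a))
    rw [finrank_fin_fun] at h2
    omega
  obtain ⟨u', hu'⟩ := exists_linearIndependent_of_le_finrank hker
  let u : Fin s → V := Submodule.subtype _ ∘ u'
  have hu : LinearIndependent K u := hu'.map' _ (Submodule.ker_subtype _)
  have hau : ∀ i, a i ∈ (Submodule.span K (Set.range u)).dualAnnihilator := by
    intro i
    have : Submodule.span K (Set.range u) ≤ LinearMap.ker (a i) := by
      rw [Submodule.span_le]
      rintro _ ⟨j, rfl⟩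
      exact congrFun (u' j).2 i
    exact (Submodule.mem_dualAnnihilator _).mpr fun x hx => this hx
  obtain ⟨d, f, hfd, hf, hf'⟩ := exists_form_of_separating (wedgeForm (K := K) (V := V) s)
    (contract k) T (x₀ := exteriorPower.ιMulti K s u) (fun τ hτ h => ha τ hτ fun i => by
      obtain ⟨θ, hθ⟩ := (exists_wedgeForm_eq_iff hu (a i)).mpr (hau i)
      rw [← hθ]
      exact h θ)
  refine ⟨_, isOpen_setOf_evalAt_ne_zero hfd, dense_setOf_evalAt_ne_zero hfd
    ((evalAt_plucker_rep_ne_zero_iff hfd hu).mpr hf), fun U hU τ hτ h => ?_⟩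
  obtain ⟨w, hw, rfl⟩ := U.exists_eq_ofLinearIndependent
  exact hf' _ ((evalAt_plucker_rep_ne_zero_iff hfd hw).mp hU) τ hτ fun θ =>
    h _ ((exists_wedgeForm_eq_iff hw _).mp ⟨θ, rfl⟩)

end Grassmannian

/-! ### From functionals on forms to tensors, ideals and points. -/

section Tensors

variable {K : Type*} [Field K] {V : Type*} [AddCommGroup V] [Module K V]

lemma tensorToForm_tprod {k : ℕ} (φ : Fin k → Dual K V) :
    tensorToForm K V k (PiTensorProduct.tprod K φ) =
      ∏ i, SymmetricAlgebra.ι K (Dual K V) (φ i) := by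
  rw [tensorToForm, PiTensorProduct.lift.tprod, MultilinearMap.compLinearMap_apply,
    MultilinearMap.mkPiAlgebra_apply]

lemma tensorToForm_mem_formsOfDegree {k : ℕ} (F : ⨂[K] _ : Fin k, Dual K V) :
    tensorToForm K V k F ∈ formsOfDegree K V k := by
  induction F using PiTensorProduct.induction_on with
  | smul_tprod r φ =>
    rw [map_smul, tensorToForm_tprod]
    have := prod_ι_mem_formsOfDegree Finset.univ φ
    rw [Finset.card_univ, Fintype.card_fin] at this
    exact Submodule.smul_mem _ r this
  | add F G hF hG => rw [map_add]; exact add_mem hF hG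

variable (K V) in
/-- `tensorToForm` as a map to the forms of degree `k`. -/
def toForm (k : ℕ) : (⨂[K] _ : Fin k, Dual K V) →ₗ[K] formsOfDegree K V k :=
  (tensorToForm K V k).codRestrict _ tensorToForm_mem_formsOfDegree

lemma toForm_tprod_cons {k : ℕ} (a : Dual K V) (φ : Fin k → Dual K V) :
    toForm K V (k + 1) (PiTensorProduct.tprod K (Fin.cons a φ : Fin (k + 1) → Dual K V)) =
      mulForm k a (toForm K V k (PiTensorProduct.tprod K φ)) := by
  refine Subtype.ext ?_
  change tensorToForm K V (k + 1) _ = _ * tensorToForm K V k _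
  rw [tensorToForm_tprod, tensorToForm_tprod, Fin.prod_univ_succ]
  rfl

lemma toForm_surjective (k : ℕ) : Function.Surjective (toForm K V k) := by
  suffices h : ∀ f ∈ formsOfDegree K V k, ∃ F, tensorToForm K V k F = f by
    rintro ⟨f, hf⟩
    obtain ⟨F, hF⟩ := h f hf
    exact ⟨F, Subtype.ext hF⟩
  induction k with
  | zero =>
    intro f hf
    rw [formsOfDegree, pow_zero, Submodule.mem_one] at hf
    obtain ⟨r, rfl⟩ := hf
    refine ⟨r • PiTensorProduct.tprod K 0, ?_⟩
    rw [map_smul, tensorToForm_tprod, Finset.univ_eq_empty, Finset.prod_empty,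
      Algebra.algebraMap_eq_smul_one]
  | succ k ih =>
    intro f hf
    refine formsOfDegree_induction (p := fun f => ∃ F, tensorToForm K V (k + 1) F = f) ?_ ?_ hf
    · rintro _ _ ⟨F, rfl⟩ ⟨G, rfl⟩
      exact ⟨F + G, map_add _ _ _⟩
    · intro a g hg
      obtain ⟨G, rfl⟩ := ih g hg
      induction G using PiTensorProduct.induction_on with
      | smul_tprod r φ =>
        refine ⟨r • PiTensorProduct.tprod K (Fin.cons a φ : Fin (k + 1) → Dual K V), ?_⟩
        rw [map_smul, map_smul, mul_smul_comm]
        exact congrArg (r • ·) (congrArg Subtype.val (toForm_tprod_cons a φ))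
      | add F G hF hG =>
        obtain ⟨F', hF'⟩ := hF (tensorToForm_mem_formsOfDegree F)
        obtain ⟨G', hG'⟩ := hG (tensorToForm_mem_formsOfDegree G)
        exact ⟨F' + G', by rw [map_add, map_add, mul_add, hF', hG']⟩

lemma toForm_reindex {k : ℕ} (σ : Equiv.Perm (Fin k)) (F : ⨂[K] _ : Fin k, Dual K V) :
    toForm K V k (PiTensorProduct.reindex K (fun _ => Dual K V) σ F) = toForm K V k F := by
  refine Subtype.ext ?_
  change tensorToForm K V k _ = tensorToForm K V k F
  induction F using PiTensorProduct.induction_on with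
  | smul_tprod r φ =>
    rw [map_smul, map_smul, map_smul, PiTensorProduct.reindex_tprod, tensorToForm_tprod,
      tensorToForm_tprod]
    congr 1
    exact Equiv.prod_comp σ.symm fun i => SymmetricAlgebra.ι K (Dual K V) (φ i)
  | add F G hF hG => rw [map_add, map_add, map_add, hF, hG]

lemma dualDistrib_reindex {k : ℕ} (σ : Equiv.Perm (Fin k)) (F : ⨂[K] _ : Fin k, Dual K V)
    (t : ⨂[K] _ : Fin k, V) :
    PiTensorProduct.dualDistrib F (PiTensorProduct.reindex K (fun _ => V) σ t) =
      PiTensorProduct.dualDistrib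
        (PiTensorProduct.reindex K (fun _ => Dual K V) σ.symm F) t := by
  induction F using PiTensorProduct.induction_on with
  | smul_tprod r φ =>
    induction t using PiTensorProduct.induction_on with
    | smul_tprod c v =>
      simp only [map_smul, LinearMap.smul_apply, PiTensorProduct.reindex_tprod,
        PiTensorProduct.dualDistrib_apply]
      congr 2
      rw [← Equiv.prod_comp σ]
      simp only [Equiv.symm_symm]
      exact Finset.prod_congr rfl fun i _ =>
        congrArg (fun j => φ (σ i) (v j)) (σ.symm_apply_apply i)
    | add t t' ht ht' => simp only [map_add, ht, ht']
  | add F G hF hG => simp only [map_add, LinearMap.add_apply, hF, hG]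

lemma dualDistrib_tprod_cons_eq_zero {k : ℕ} {U : Submodule K V} {a : Dual K V}
    (ha : a ∈ U.dualAnnihilator) (φ : Fin k → Dual K V) {t : ⨂[K] _ : Fin (k + 1), V}
    (ht : t ∈ tensorPowerOf U (k + 1)) :
    PiTensorProduct.dualDistrib
      (PiTensorProduct.tprod K (Fin.cons a φ : Fin (k + 1) → Dual K V)) t = 0 := by
  obtain ⟨t, rfl⟩ := ht
  induction t using PiTensorProduct.induction_on with
  | smul_tprod c v =>
    rw [map_smul, map_smul, PiTensorProduct.map_tprod, PiTensorProduct.dualDistrib_apply,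
      Fin.prod_univ_succ, Fin.cons_zero,
      show a (U.subtype (v 0)) = 0 from (Submodule.mem_dualAnnihilator a).mp ha _ (v 0).2,
      zero_mul, smul_zero]
  | add t t' ht ht' => rw [map_add, map_add, ht, ht', add_zero]

/-- Evaluation at a point as a functional on the forms of degree `k`. -/
def evalForm (k : ℕ) (ψ : V) : Dual K (formsOfDegree K V k) :=
  (evalAt ψ).toLinearMap.domRestrict (formsOfDegree K V k)

lemma evalForm_apply (k : ℕ) (ψ : V) (f : formsOfDegree K V k) :
    evalForm k ψ f = evalAt ψ (f : PolyRing K V) := rfl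

lemma contract_evalForm_eq_zero (k : ℕ) {a : Dual K V} {ψ : V} (h : a ψ = 0) :
    contract k a (evalForm k ψ) = 0 := by
  match k with
  | 0 => rfl
  | k + 1 =>
    refine contract_succ_eq_zero_iff.mpr fun f => ?_
    rw [evalForm_apply, mulForm_coe, map_mul, evalAt_ι, h, zero_mul]

lemma evalForm_ne_zero (k : ℕ) {ψ : V} (hψ : ψ ≠ 0) : evalForm (K := K) k ψ ≠ 0 := by
  obtain ⟨a, ha⟩ := not_forall.mp ((Module.forall_dual_apply_eq_zero_iff K ψ).not.mpr hψ)
  intro h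
  have := LinearMap.congr_fun h
    (toForm K V k (PiTensorProduct.tprod K fun _ : Fin k => a))
  rw [evalForm_apply, LinearMap.zero_apply, toForm, LinearMap.codRestrict_apply,
    tensorToForm_tprod, Finset.prod_const, map_pow, evalAt_ι] at this
  exact ha (eq_zero_of_pow_eq_zero this)

/-- The functionals on the forms of degree `k` that vanish on `I_k`. -/
def idealAnnihilator (I : Ideal (PolyRing K V)) (k : ℕ) :
    Submodule K (Dual K (formsOfDegree K V k)) :=
  ((idealPart I k).comap (formsOfDegree K V k).subtype).dualAnnihilator

/-- The span of the evaluations of forms of degree `k` at the points of `X`. -/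
def evalSpan (X : Set (ℙ K V)) (k : ℕ) : Submodule K (Dual K (formsOfDegree K V k)) :=
  Submodule.span K {τ | ∃ (ψ : V) (hψ : ψ ≠ 0), Projectivization.mk K ψ hψ ∈ X ∧
    τ = evalForm k ψ}

lemma mem_idealAnnihilator {I : Ideal (PolyRing K V)} {k : ℕ}
    {τ : Dual K (formsOfDegree K V k)} :
    τ ∈ idealAnnihilator I k ↔ ∀ f : formsOfDegree K V k, (f : PolyRing K V) ∈ I → τ f = 0 := by
  rw [idealAnnihilator, Submodule.mem_dualAnnihilator]
  exact forall_congr' fun f => ⟨fun h hf => h ⟨hf, f.2⟩, fun h hf => h hf.1⟩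

variable {k : ℕ} {T : Submodule K (Dual K (formsOfDegree K V k))} {U : Submodule K V}

/-- A point of $X$ in $U$ would give a nonzero evaluation in $T$ that every form vanishing on $U$
contracts to zero. -/
lemma isTangled_of_separating {X : Set (ℙ K V)} (hX : ∀ p ∈ X, evalForm k p.rep ∈ T)
    (h : ∀ τ ∈ T, (∀ a ∈ U.dualAnnihilator, contract k a τ = 0) → τ = 0) : IsTangled X U := by
  refine Set.eq_empty_of_forall_notMem ?_
  rintro p ⟨hpU, hpX⟩
  refine evalForm_ne_zero k p.rep_nonzero (h _ (hX p hpX) fun a ha => ?_)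
  have hp : p.rep ∈ U := hpU (p.submodule_eq ▸ Submodule.mem_span_singleton_self p.rep)
  exact contract_evalForm_eq_zero k ((Submodule.mem_dualAnnihilator a).mp ha _ hp)

lemma contract_eq_zero_of_mem_idealAnnihilator {τ : Dual K (formsOfDegree K V k)}
    (hτ : τ ∈ idealAnnihilator (idealOfSubspace U) k) {a : Dual K V}
    (ha : a ∈ U.dualAnnihilator) : contract k a τ = 0 := by
  match k with
  | 0 => rfl
  | k + 1 =>
    refine contract_succ_eq_zero_iff.mpr fun f => mem_idealAnnihilator.mp hτ _ ?_
    refine (Submodule.mem_iInf _).mpr fun ψ => (Submodule.mem_iInf _).mpr fun hψ => ?_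
    rw [RingHom.mem_ker, mulForm_coe, map_mul, evalAt_ι, (Submodule.mem_dualAnnihilator a).mp ha ψ hψ, zero_mul]

/-- By duality it suffices that no nonzero functional kills both summands; killing $I(U)_k$ forces
the contractions with forms vanishing on $U$ to be zero. -/
lemma idealPart_sup_idealPart_eq {I : Ideal (PolyRing K V)}
    (h : ∀ τ ∈ idealAnnihilator I k, (∀ a ∈ U.dualAnnihilator, contract k a τ = 0) → τ = 0) :
    idealPart I k ⊔ idealPart (idealOfSubspace U) k = formsOfDegree K V k := by
  refine le_antisymm (sup_le inf_le_right inf_le_right) ?_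
  have hbot : ((idealPart I k ⊔ idealPart (idealOfSubspace U) k).comap
      (formsOfDegree K V k).subtype).dualAnnihilator = ⊥ := by
    rw [Submodule.eq_bot_iff]
    intro τ hτ
    rw [Submodule.mem_dualAnnihilator] at hτ
    refine h τ (mem_idealAnnihilator.mpr fun f hf => ?_) fun a ha =>
      contract_eq_zero_of_mem_idealAnnihilator (mem_idealAnnihilator.mpr fun f hf => ?_) ha
    · exact hτ f (Submodule.mem_sup_left ⟨hf, f.2⟩)
    · exact hτ f (Submodule.mem_sup_right ⟨hf, f.2⟩)
  have htop := congrArg Submodule.dualCoannihilator hbot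
  rw [Subspace.dualAnnihilator_dualCoannihilator_eq, Submodule.dualCoannihilator_bot] at htop
  intro f hf
  have : (⟨f, hf⟩ : formsOfDegree K V k) ∈ (idealPart I k ⊔ idealPart (idealOfSubspace U) k).comap
      (formsOfDegree K V k).subtype := htop ▸ Submodule.mem_top
  exact this

variable [FiniteDimensional K V]

variable (K V) in
/-- The pairing identifies `V^{⊗k}` with the dual of `(V*)^{⊗k}`. -/
def tensorEquivDual (k : ℕ) :
    (⨂[K] _ : Fin k, V) ≃ₗ[K] Dual K (⨂[K] _ : Fin k, Dual K V) :=
  (Module.evalEquiv K (⨂[K] _ : Fin k, V)).trans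
    (PiTensorProduct.dualDistribEquiv (R := K) (M := fun _ : Fin k => V)).dualMap

variable (K V) in
/-- The symmetric tensor that represents a functional on the forms of degree `k`. -/
def dualFormToTensor (k : ℕ) : Dual K (formsOfDegree K V k) →ₗ[K] ⨂[K] _ : Fin k, V :=
  (tensorEquivDual K V k).symm.toLinearMap ∘ₗ (toForm K V k).dualMap

lemma dualFormToTensor_eq_iff {k : ℕ} {τ : Dual K (formsOfDegree K V k)}
    {t : ⨂[K] _ : Fin k, V} :
    dualFormToTensor K V k τ = t ↔
      ∀ F, PiTensorProduct.dualDistrib F t = τ (toForm K V k F) := by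
  change (tensorEquivDual K V k).symm _ = t ↔ _
  rw [LinearEquiv.symm_apply_eq, LinearMap.ext_iff]
  exact forall_congr' fun F => eq_comm

lemma dualDistrib_dualFormToTensor {k : ℕ} (τ : Dual K (formsOfDegree K V k))
    (F : ⨂[K] _ : Fin k, Dual K V) :
    PiTensorProduct.dualDistrib F (dualFormToTensor K V k τ) = τ (toForm K V k F) :=
  dualFormToTensor_eq_iff.mp rfl F

lemma dualFormToTensor_injective (k : ℕ) : Function.Injective (dualFormToTensor K V k) :=
  (tensorEquivDual K V k).symm.injective.comp
    (LinearMap.dualMap_injective_of_surjective (toForm_surjective k))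

lemma finrank_map_dualFormToTensor {k : ℕ} (T : Submodule K (Dual K (formsOfDegree K V k))) :
    finrank K (T.map (dualFormToTensor K V k)) = finrank K T :=
  (LinearEquiv.finrank_eq (Submodule.equivMapOfInjective _ (dualFormToTensor_injective k) T)).symm

lemma dualFormToTensor_mem_symTensors {k : ℕ} (τ : Dual K (formsOfDegree K V k)) :
    dualFormToTensor K V k τ ∈ symTensors K V k := by
  refine (Submodule.mem_iInf _).mpr fun σ => ?_
  change PiTensorProduct.reindex K (fun _ => V) σ _ = _
  refine (dualFormToTensor_eq_iff.mpr fun F => ?_).symm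
  rw [dualDistrib_reindex, dualDistrib_dualFormToTensor, toForm_reindex]

lemma dualFormToTensor_evalForm (k : ℕ) (ψ : V) :
    dualFormToTensor K V k (evalForm k ψ) = PiTensorProduct.tprod K fun _ => ψ := by
  rw [dualFormToTensor_eq_iff]
  intro F
  change _ = evalAt ψ (tensorToForm K V k F)
  induction F using PiTensorProduct.induction_on with
  | smul_tprod r φ =>
    rw [map_smul, map_smul, map_smul, tensorToForm_tprod, LinearMap.smul_apply,
      PiTensorProduct.dualDistrib_apply, map_prod]
    simp only [evalAt_ι]
  | add F G hF hG => rw [map_add, map_add, map_add, LinearMap.add_apply, hF, hG]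

lemma map_idealAnnihilator (I : Ideal (PolyRing K V)) (k : ℕ) :
    (idealAnnihilator I k).map (dualFormToTensor K V k) = idealPerp I k := by
  apply le_antisymm
  · rintro _ ⟨τ, hτ, rfl⟩
    refine ⟨dualFormToTensor_mem_symTensors τ, fun F hF => ?_⟩
    rw [dualDistrib_dualFormToTensor]
    exact mem_idealAnnihilator.mp hτ _ hF.1
  · rintro t ⟨-, ht⟩
    obtain ⟨g, hg⟩ := LinearMap.exists_rightInverse_of_surjective (toForm K V k)
      (LinearMap.range_eq_top.mpr (toForm_surjective k))
    have hg' : ∀ f, toForm K V k (g f) = f := LinearMap.congr_fun hg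
    refine ⟨tensorEquivDual K V k t ∘ₗ g, mem_idealAnnihilator.mpr fun f hf => ?_, ?_⟩
    · refine ht (g f) ?_
      change (toForm K V k (g f) : PolyRing K V) ∈ _
      rw [hg']
      exact ⟨hf, f.2⟩
    · refine dualFormToTensor_eq_iff.mpr fun F => ?_
      -- This difference represents $0\in I_k$, so `t` pairs to zero with it: the pairing with `t`
      -- descends to forms. No division by $k!$ occurs, so the characteristic is arbitrary.
      have h0 : toForm K V k (F - g (toForm K V k F)) = 0 := by rw [map_sub, hg', sub_self]
      have := ht (F - g (toForm K V k F)) (by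
        change (toForm K V k _ : PolyRing K V) ∈ _
        rw [h0]
        exact zero_mem _)
      rw [map_sub, LinearMap.sub_apply, sub_eq_zero] at this
      exact this

lemma map_evalSpan (X : Set (ℙ K V)) (k : ℕ) :
    (evalSpan X k).map (dualFormToTensor K V k) = varietyPower X k := by
  rw [evalSpan, Submodule.map_span, varietyPower]
  congr 1
  ext t
  constructor
  · rintro ⟨_, ⟨ψ, hψ, hX, rfl⟩, rfl⟩
    exact ⟨ψ, hψ, hX, dualFormToTensor_evalForm k ψ⟩
  · rintro ⟨ψ, hψ, hX, rfl⟩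
    exact ⟨_, ⟨ψ, hψ, hX, rfl⟩, dualFormToTensor_evalForm k ψ⟩

/-- Contraction with `a` amounts to putting `a` in the first tensor slot, which kills $U^{\otimes
k}$ when `a` vanishes on $U$. -/
lemma map_inf_tensorPowerOf_eq_bot
    (h : ∀ τ ∈ T, (∀ a ∈ U.dualAnnihilator, contract k a τ = 0) → τ = 0) :
    T.map (dualFormToTensor K V k) ⊓ tensorPowerOf U k = ⊥ := by
  rw [Submodule.eq_bot_iff]
  rintro _ ⟨⟨τ, hτ, rfl⟩, hU⟩
  rw [h τ hτ fun a ha => ?_, map_zero]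
  match k with
  | 0 => rfl
  | k + 1 =>
    have h0 : (τ ∘ₗ mulForm k a) ∘ₗ toForm K V k = 0 := by
      refine PiTensorProduct.ext (MultilinearMap.ext fun φ => ?_)
      change τ (mulForm k a (toForm K V k (PiTensorProduct.tprod K φ))) = 0
      rw [← toForm_tprod_cons, ← dualDistrib_dualFormToTensor]
      exact dualDistrib_tprod_cons_eq_zero ha φ hU
    refine contract_succ_eq_zero_iff.mpr fun f => ?_
    obtain ⟨F, rfl⟩ := toForm_surjective k f
    exact LinearMap.congr_fun h0 F

end Tensors

end Tangled

end

theorem mainTheorem3 {K : Type*} [Field K] [Infinite K]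
    {V : Type*} [AddCommGroup V] [Module K V] [FiniteDimensional K V]
    (N s k : ℕ) (hN : Module.finrank K V = N) (hs : 1 ≤ s) (hsN : s ≤ N) (hk : 1 ≤ k)
    (I : Ideal (Tangled.PolyRing K V)) (hI : Tangled.IsHomogeneousIdeal I) :
    (Module.finrank K (Tangled.idealPerp I k) < (N - s + k).choose k →
      Tangled.HoldsGenerically s fun U : Submodule K V =>
        Tangled.idealPart I k ⊔ Tangled.idealPart (Tangled.idealOfSubspace U) k =
            Tangled.formsOfDegree K V k ∧
          Tangled.idealPerp I k ⊓ Tangled.tensorPowerOf U k = ⊥ ∧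
          Tangled.IsTangled (Tangled.zeroLocus I) U) ∧
    (Module.finrank K (Tangled.varietyPower (Tangled.zeroLocus I) k) < (N - s + k).choose k →
      Tangled.HoldsGenerically s fun U : Submodule K V =>
        Tangled.IsTangled (Tangled.zeroLocus I) U ∧
          Tangled.varietyPower (Tangled.zeroLocus I) k ⊓ Tangled.tensorPowerOf U k = ⊥) := by
  open Tangled in
  subst hN
  -- Both tensor spaces become images of spaces of functionals of the same dimension, so one
  -- genericity theorem serves both parts.
  rw [← map_idealAnnihilator, ← map_evalSpan, finrank_map_dualFormToTensor,
    finrank_map_dualFormToTensor]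
  refine ⟨fun h => (holdsGenerically_separating hsN _ h).mono fun U hU =>
      ⟨idealPart_sup_idealPart_eq hU, map_inf_tensorPowerOf_eq_bot hU,
        isTangled_of_separating (fun p hp => ?_) hU⟩,
    fun h => (holdsGenerically_separating hsN _ h).mono fun U hU =>
      ⟨isTangled_of_separating (fun p hp => ?_) hU, map_inf_tensorPowerOf_eq_bot hU⟩⟩
  · exact mem_idealAnnihilator.mpr fun f hf => hp f hf
  · exact Submodule.subset_span ⟨p.rep, p.rep_nonzero, by rwa [p.mk_rep], rfl⟩
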